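/- Let $X$ be a complex Hilbert space, and let $A,B,C$ be closed densely defined linear operators in $X$ with $B$ and $C$ self-adjoint. Let $$H=\begin{pmatrix}A&B\\ C&-A^*\end{pmatrix}$$ be the operator in the Hilbert space $X\times X$ with domain $\mathcal D(H)=(\mathcal D(A)\cap\mathcal D(C))\times(\mathcal D(B)\cap\mathcal D(A^*))$ acting by $H(x,y)=(Ax+By,\;Cx-A^*y)$, and suppose that $H$ is densely defined. Let $J=\begin{pmatrix}0&I\\-I&0\end{pmatrix}$, that is, $J(x,y)=(y,-x)$. An operator $S$ is called $T$-bounded if $\mathcal D(T)\subset\mathcal D(S)$ and there are constants $a,b\ge 0$ such that $\|Sx\|\le a\|Tx\|+b\|x\|$ for all $x\in\mathcal D(T)$; the infimum of all $a\ge0$ for which such a $b$ exists is called the relative bound (of $S$ with respect to $T$). Suppose that $\mathcal D(H)=\mathcal D(A)\times\mathcal D(A^*)$ and that $A$ is self-adjoint. Then $JH=(JH)^*$ (equality of unbounded operators, including domains) if one of the following holds: 1. $C$ is $A$-bounded with relative bound $<1$ and $B$ is $A^*$-bounded with relative bound $\le 1$; 2. $C$ is $A$-bounded with relative bound $\le 1$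 and $B$ is $A^*$-bounded with relative bound $<1$. -/

import Mathlib

open scoped LinearPMap

noncomputable section

section RelativeBound

variable {E F G : Type*} [NormedAddCommGroup E] [NormedSpace ℂ E]
  [NormedAddCommGroup F] [NormedSpace ℂ F] [NormedAddCommGroup G] [NormedSpace ℂ G]

/-- The set of admissible constants `a ≥ 0` in an estimate
`‖S x‖ ≤ a * ‖T x‖ + b * ‖x‖` for all `x ∈ D(T)` (which is required to lie in `D(S)`),
with some `b ≥ 0` that may depend on `a`. -/
def relBoundSet (S : E →ₗ.[ℂ] F) (T : E →ₗ.[ℂ] G) : Set ℝ :=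
  {a | 0 ≤ a ∧ ∃ hdom : T.domain ≤ S.domain, ∃ b : ℝ, 0 ≤ b ∧
    ∀ x : T.domain, ‖S ⟨(x : E), hdom x.2⟩‖ ≤ a * ‖T x‖ + b * ‖(x : E)‖}

/-- `S` is `T`-bounded (relatively bounded with respect to `T`). -/
def IsRelBounded (S : E →ₗ.[ℂ] F) (T : E →ₗ.[ℂ] G) : Prop :=
  (relBoundSet S T).Nonempty

/-- The `T`-bound of `S`: the infimum of the admissible constants `a`.
It is meaningful when `S` is `T`-bounded. -/
def relBound (S : E →ₗ.[ℂ] F) (T : E →ₗ.[ℂ] G) : ℝ :=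
  sInf (relBoundSet S T)

end RelativeBound

section Block

variable {X Y : Type*} [NormedAddCommGroup X] [InnerProductSpace ℂ X]
  [NormedAddCommGroup Y] [InnerProductSpace ℂ Y]

/-- The product `p × q` of two subspaces, inside the Hilbert space product `X × Y`. -/
def l2Prod (p : Submodule ℂ X) (q : Submodule ℂ Y) : Submodule ℂ (WithLp 2 (X × Y)) :=
  (p.prod q).comap (WithLp.linearEquiv 2 ℂ (X × Y)).toLinearMap

theorem mem_l2Prod {p : Submodule ℂ X} {q : Submodule ℂ Y} {z : WithLp 2 (X × Y)} :
    z ∈ l2Prod p q ↔ z.fst ∈ p ∧ z.snd ∈ q := Iff.rfl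

/-- The operator on `X × Y` induced by the block operator matrix with rows `(A, B)`, `(C, D)`,
with domain `(D(A) ∩ D(C)) × (D(B) ∩ D(D))`. -/
def blockOperator (A : X →ₗ.[ℂ] X) (B : Y →ₗ.[ℂ] X) (C : X →ₗ.[ℂ] Y) (D : Y →ₗ.[ℂ] Y) :
    WithLp 2 (X × Y) →ₗ.[ℂ] WithLp 2 (X × Y) where
  domain := l2Prod (A.domain ⊓ C.domain) (B.domain ⊓ D.domain)
  toFun :=
    { toFun := fun z => WithLp.toLp 2
        (A ⟨z.1.fst, z.2.1.1⟩ + B ⟨z.1.snd, z.2.2.1⟩,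
          C ⟨z.1.fst, z.2.1.2⟩ + D ⟨z.1.snd, z.2.2.2⟩)
      map_add' := by
        intro z w
        have hA := A.map_add ⟨z.1.fst, z.2.1.1⟩ ⟨w.1.fst, w.2.1.1⟩
        have hB := B.map_add ⟨z.1.snd, z.2.2.1⟩ ⟨w.1.snd, w.2.2.1⟩
        have hC := C.map_add ⟨z.1.fst, z.2.1.2⟩ ⟨w.1.fst, w.2.1.2⟩
        have hD := D.map_add ⟨z.1.snd, z.2.2.2⟩ ⟨w.1.snd, w.2.2.2⟩
        rw [← WithLp.toLp_add, Prod.mk_add_mk]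
        refine congrArg (WithLp.toLp 2) (Prod.ext ?_ ?_)
        · exact (congrArg₂ (· + ·) hA hB).trans (add_add_add_comm _ _ _ _)
        · exact (congrArg₂ (· + ·) hC hD).trans (add_add_add_comm _ _ _ _)
      map_smul' := by
        intro c z
        have hA := A.map_smul c ⟨z.1.fst, z.2.1.1⟩
        have hB := B.map_smul c ⟨z.1.snd, z.2.2.1⟩
        have hC := C.map_smul c ⟨z.1.fst, z.2.1.2⟩
        have hD := D.map_smul c ⟨z.1.snd, z.2.2.2⟩
        rw [RingHom.id_apply, ← WithLp.toLp_smul, Prod.smul_mk, smul_add, smul_add]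
        refine congrArg (WithLp.toLp 2) (Prod.ext ?_ ?_)
        · exact congrArg₂ (· + ·) hA hB
        · exact congrArg₂ (· + ·) hC hD }

end Block

section Hamiltonian

variable {X : Type*} [NormedAddCommGroup X] [InnerProductSpace ℂ X]

/-- The unit symplectic operator matrix `J (x, y) = (y, -x)` on `X × X`. -/
def symplecticJ (X : Type*) [NormedAddCommGroup X] [InnerProductSpace ℂ X] :
    WithLp 2 (X × X) →ₗ[ℂ] WithLp 2 (X × X) where
  toFun z := WithLp.toLp 2 (z.snd, -z.fst)
  map_add' z w := by
    refine congrArg (WithLp.toLp 2) (Prod.ext rfl ?_)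
    exact neg_add z.fst w.fst
  map_smul' c z := by
    refine congrArg (WithLp.toLp 2) (Prod.ext rfl ?_)
    exact (smul_neg c z.fst).symm

variable [CompleteSpace X]

/-- The operator induced by the block operator matrix with rows `(A, B)` and `(C, -A*)`. -/
def hamiltonianOperator (A B C : X →ₗ.[ℂ] X) :
    WithLp 2 (X × X) →ₗ.[ℂ] WithLp 2 (X × X) :=
  blockOperator A B C (-A†)

/-- The matrix with rows `(A, B)` and `(C, -A*)` is a Hamiltonian operator matrix.
(Self-adjoint operators are closed and densely defined.) -/
structure IsHamiltonianMatrix (A B C : X →ₗ.[ℂ] X) : Prop where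
  dense_A : Dense (A.domain : Set X)
  closed_A : A.IsClosed
  selfAdjoint_B : IsSelfAdjoint B
  selfAdjoint_C : IsSelfAdjoint C
  dense_H : Dense ((hamiltonianOperator A B C).domain : Set (WithLp 2 (X × X)))

end Hamiltonian

end

/-! ### Criteria for self-adjointness and surjectivity -/

open Complex

/-! Since `A† = A`, `JH` has rows `(C, -A)`, `(-A, -B)`: it is `T + diag (C, -B)` with `T`
off-diagonal and self-adjoint on `D(A) × D(A)`. The hypotheses give bounds `c₁` for `C` and `c₂` for
`B` with `c₁ * c₂ < 1`. Conjugating by `diag (s, s⁻¹)` fixes `T` and turns these into `s² c₁` and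
`s⁻² c₂`, both below one for suitable `s`. A Kato–Rellich argument then makes the scaled operator
plus `± iμ` surjective (`exists_block_eq`). Undoing the scaling replaces `μ` by `diag (s⁻² μ, s²
μ)`, hence the criterion `LinearPMap.eq_adjoint_of_surjective` with a symmetric `P` in place of a
scalar. -/

/-- A symmetric densely defined operator `M` is self-adjoint as soon as `M + i P` and `M - i P` are
surjective for some everywhere defined symmetric operator `P`. -/
theorem LinearPMap.eq_adjoint_of_surjective {E : Type*} [NormedAddCommGroup E]
    [InnerProductSpace ℂ E] [CompleteSpace E] {M : E →ₗ.[ℂ] E} (hd : Dense (M.domain : Set E))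
    (hM : M.IsFormalAdjoint M) {P : E →ₗ[ℂ] E} (hP : P.IsSymmetric)
    (hadd : ∀ f, ∃ z : M.domain, M z + I • P z = f)
    (hsub : ∀ f, ∃ z : M.domain, M z - I • P z = f) : M = M† := by
  have hle : M ≤ M† := hM.le_adjoint hd
  refine LinearPMap.eq_of_le_of_domain_eq hle (le_antisymm hle.1 fun w hw => ?_)
  -- `(M† + iP)(w - z) = 0`, so `w - z` is orthogonal to the range of `M - iP`, which contains `w -
  -- z` itself.
  obtain ⟨z, hz⟩ := hadd (M† ⟨w, hw⟩ + I • P w)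
  obtain ⟨z', hz'⟩ := hsub (w - z)
  have h1 := LinearPMap.adjoint_isFormalAdjoint hd ⟨w, hw⟩ z'
  have h2 := hM z z'
  have h3 := hP w z'
  have h4 := hP (z : E) z'
  have h5 := congrArg (fun t => inner ℂ t (z' : E)) hz
  simp only [inner_add_left, inner_smul_left, conj_I] at h5
  have h6 : inner ℂ (w - z) (w - z) = 0 := by
    nth_rewrite 2 [← hz']
    simp only [inner_sub_left, inner_sub_right, inner_smul_right]
    linear_combination (-1 : ℂ) * h1 + h2 + I * h3 - I * h4 - h5
  have h7 : w = z := sub_eq_zero.mp (inner_self_eq_zero.mp h6)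
  rw [h7]
  exact z.2

theorem LinearPMap.norm_sq_add_smul_I {E : Type*} [NormedAddCommGroup E] [InnerProductSpace ℂ E]
    {A : E →ₗ.[ℂ] E} (hA : A.IsFormalAdjoint A) (ν : ℝ) (x : A.domain) :
    ‖A x + (ν * I) • (x : E)‖ ^ 2 = ‖A x‖ ^ 2 + ν ^ 2 * ‖(x : E)‖ ^ 2 := by
  have hre : (inner ℂ (A x) (x : E)).im = 0 := by
    have h := hA x x
    rw [← inner_conj_symm (x : E)] at h
    exact conj_eq_iff_im.mp h.symm
  rw [@norm_add_sq ℂ, inner_smul_right, norm_smul]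
  simp [hre, mul_pow]

theorem IsSelfAdjoint.isFormalAdjoint {E : Type*} [NormedAddCommGroup E] [InnerProductSpace ℂ E]
    [CompleteSpace E] {A : E →ₗ.[ℂ] E} (hA : IsSelfAdjoint A) : A.IsFormalAdjoint A := by
  have h := LinearPMap.adjoint_isFormalAdjoint hA.dense_domain
  rwa [LinearPMap.isSelfAdjoint_def.mp hA] at h

/-- The basic criterion: nonreal numbers are not in the spectrum of a self-adjoint operator. -/
theorem IsSelfAdjoint.exists_add_smul_I_eq {E : Type*} [NormedAddCommGroup E]
    [InnerProductSpace ℂ E] [CompleteSpace E] {A : E →ₗ.[ℂ] E} (hA : IsSelfAdjoint A) {ν : ℝ}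
    (hν : ν ≠ 0) (f : E) : ∃ x : A.domain, A x + (ν * I) • (x : E) = f := by
  have hsymm := hA.isFormalAdjoint
  let F : A.graph →L[ℂ] E :=
    (ContinuousLinearMap.snd ℂ E E + (ν * I) • ContinuousLinearMap.fst ℂ E E).comp A.graph.subtypeL
  have hF (x : A.domain) : F ⟨(x, A x), A.mem_graph x⟩ = A x + (ν * I) • (x : E) := rfl
  have hgraph : CompleteSpace A.graph := hA.isClosed.completeSpace_coe
  -- `F` is bounded below in the graph norm and the graph is complete, so the range is closed.
  have hbound : ∀ z, ‖z‖ ≤ ((1 + ‖ν‖₊⁻¹ : NNReal) : ℝ) * ‖F z‖ := by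
    rintro ⟨⟨u, v⟩, hz⟩
    obtain ⟨x, rfl, rfl⟩ := A.mem_graph_iff.mp hz
    have hsq := LinearPMap.norm_sq_add_smul_I hsymm ν x
    rw [hF]
    set r := ‖A x + (ν * I) • (x : E)‖
    have hr : 0 ≤ r := norm_nonneg _
    have h1 : ‖A x‖ ≤ r := by
      refine abs_le_of_sq_le_sq' ?_ hr |>.2
      rw [hsq]
      exact le_add_of_nonneg_right (by positivity)
    have h2 : |ν| * ‖(x : E)‖ ≤ r := by
      refine abs_le_of_sq_le_sq' ?_ hr |>.2
      rw [hsq, mul_pow, sq_abs]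
      exact le_add_of_nonneg_left (by positivity)
    have hν' : 0 < |ν| := abs_pos.mpr hν
    have h3 : ‖(x : E)‖ ≤ |ν|⁻¹ * r := by
      rw [inv_mul_eq_div, le_div_iff₀ hν']
      linarith
    have h4 : 0 ≤ |ν|⁻¹ * r := by positivity
    change max ‖(x : E)‖ ‖A x‖ ≤ (1 + |ν|⁻¹) * r
    exact max_le (by linarith) (by linarith)
  have hclosed : IsClosed (F.range : Set E) := by
    rw [LinearMap.coe_range]
    exact (F.antilipschitz_of_bound hbound).isClosed_range F.uniformContinuous
  have : CompleteSpace F.range := hclosed.completeSpace_coe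
  have htop : F.range = ⊤ := by
    rw [← Submodule.orthogonal_eq_bot_iff, Submodule.eq_bot_iff]
    intro w hw
    -- A vector orthogonal to the range is an eigenvector of `A† = A` for `iν`, hence zero.
    have hw' (x : A.domain) : inner ℂ ((ν * I) • w) (x : E) = inner ℂ w (A x) := by
      have h := (Submodule.mem_orthogonal' _ _).mp hw _ ⟨⟨(x, A x), A.mem_graph x⟩, rfl⟩
      change inner ℂ w (A x + (ν * I) • (x : E)) = 0 at h
      rw [inner_add_right, inner_smul_right] at h
      rw [inner_smul_left, map_mul, conj_ofReal, conj_I]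
      linear_combination -h
    have hmem : w ∈ A†.domain := LinearPMap.mem_adjoint_domain_of_exists w ⟨_, hw'⟩
    rw [LinearPMap.isSelfAdjoint_def.mp hA] at hmem
    have hAw : A ⟨w, hmem⟩ = (ν * I) • w :=
      hA.dense_domain.eq_of_inner_left ℂ fun x hx =>
        (hsymm ⟨w, hmem⟩ ⟨x, hx⟩).trans (hw' ⟨x, hx⟩).symm
    have hsq := LinearPMap.norm_sq_add_smul_I hsymm (-ν) ⟨w, hmem⟩
    rw [hAw] at hsq
    simp only [ofReal_neg, neg_mul, neg_smul, add_neg_cancel, norm_zero] at hsq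
    have : ν ^ 2 * ‖w‖ ^ 2 = 0 := by
      nlinarith [sq_nonneg ‖(ν * I) • w‖, mul_nonneg (sq_nonneg ν) (sq_nonneg ‖w‖)]
    simpa [hν] using this
  obtain ⟨⟨⟨u, v⟩, hz⟩, h⟩ : f ∈ F.range := htop ▸ Submodule.mem_top
  obtain ⟨x, rfl, rfl⟩ := A.mem_graph_iff.mp hz
  exact ⟨x, h⟩

/-- A surjective linear map onto a Banach space stays surjective under perturbations that are
relatively bounded with a constant less than one. -/
theorem LinearMap.surjective_add_of_norm_le {V Y : Type*} [AddCommGroup V] [Module ℂ V]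
    [NormedAddCommGroup Y] [NormedSpace ℂ Y] [CompleteSpace Y] {G K : V →ₗ[ℂ] Y}
    (hG : Function.Surjective G) {c : ℝ} (hc : c < 1) (hK : ∀ v, ‖K v‖ ≤ c * ‖G v‖) :
    Function.Surjective (G + K) := by
  -- `(G + K) R = 1 + K R` is inverted by a Neumann series; only `K R` has to be bounded, not `R`.
  obtain ⟨R, hR⟩ := G.exists_rightInverse_of_surjective (LinearMap.range_eq_top.mpr hG)
  have hGR (f : Y) : G (R f) = f := LinearMap.congr_fun hR f
  let L : Y →L[ℂ] Y := (K ∘ₗ R).mkContinuous c fun f => by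
    simpa [hGR] using hK (R f)
  have hL : ‖-L‖ < 1 := by
    rw [norm_neg]
    exact ((K ∘ₗ R).mkContinuous_norm_le' _).trans_lt (max_lt hc one_pos)
  obtain ⟨U, hU⟩ := isUnit_one_sub_of_norm_lt_one hL
  intro f
  refine ⟨R ((↑U⁻¹ : Y →L[ℂ] Y) f), ?_⟩
  have h : (U : Y →L[ℂ] Y) ((↑U⁻¹ : Y →L[ℂ] Y) f) = f := by
    rw [← mul_apply_eq_comp, Units.mul_inv, one_apply_eq_self]
  rw [hU, sub_neg_eq_add] at h
  rw [LinearMap.add_apply, hGR]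
  exact h

/-- Convexity of the square with weights `c` and `1 - c`, applied to `u` and `b v / (1 - c)`. -/
theorem add_mul_sq_le_of_lt_one {c b μ u v : ℝ} (hc0 : 0 < c) (hc1 : c < 1)
    (hμ : b ^ 2 ≤ c * (1 - c) * μ ^ 2) :
    (c * u + b * v) ^ 2 ≤ c * (u ^ 2 + μ ^ 2 * v ^ 2) := by
  have h1 : 0 < 1 - c := by linarith
  have h2 : (1 - c) * (c * u + b * v) ^ 2 ≤ (1 - c) * (c * (u ^ 2 + μ ^ 2 * v ^ 2)) := by
    nlinarith [mul_nonneg hc0.le (sq_nonneg ((1 - c) * u - b * v)),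
      mul_le_mul_of_nonneg_right hμ (sq_nonneg v)]
  exact le_of_mul_le_mul_left h2 h1

/-! ### Kato–Rellich for the block matrix -/

section BlockPerturbation

variable {X : Type*} [NormedAddCommGroup X] [InnerProductSpace ℂ X] {A : X →ₗ.[ℂ] X}

/-- The operator matrix with rows `(iν, -A)` and `(-A, iν)`. -/
def offDiagonalResolvent (A : X →ₗ.[ℂ] X) (ν : ℝ) :
    (A.domain × A.domain) →ₗ[ℂ] WithLp 2 (X × X) :=
  (WithLp.linearEquiv 2 ℂ (X × X)).symm.toLinearMap ∘ₗ
    (((ν * I) • A.domain.subtype ∘ₗ LinearMap.fst ℂ _ _ - A.toFun ∘ₗ LinearMap.snd ℂ _ _).prod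
      ((ν * I) • A.domain.subtype ∘ₗ LinearMap.snd ℂ _ _ - A.toFun ∘ₗ LinearMap.fst ℂ _ _))

theorem offDiagonalResolvent_apply (ν : ℝ) (z : A.domain × A.domain) :
    offDiagonalResolvent A ν z =
      WithLp.toLp 2 ((ν * I) • (z.1 : X) - A z.2, (ν * I) • (z.2 : X) - A z.1) := rfl

/-- The cross terms of the two components cancel by symmetry of `A`. -/
theorem norm_sq_offDiagonalResolvent (hA : A.IsFormalAdjoint A) (ν : ℝ)
    (z : A.domain × A.domain) :
    ‖offDiagonalResolvent A ν z‖ ^ 2 =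
      (‖A z.1‖ ^ 2 + ν ^ 2 * ‖(z.1 : X)‖ ^ 2) + (‖A z.2‖ ^ 2 + ν ^ 2 * ‖(z.2 : X)‖ ^ 2) := by
  obtain ⟨x, y⟩ := z
  have h : (inner ℂ (x : X) (A y)).im = -(inner ℂ (y : X) (A x)).im := by
    rw [← hA, ← inner_conj_symm, conj_im]
  rw [offDiagonalResolvent_apply, WithLp.prod_norm_sq_eq_of_L2]
  simp only [WithLp.toLp_fst, WithLp.toLp_snd, @norm_sub_sq ℂ, inner_smul_left, norm_smul]
  simp [mul_pow, h]
  ring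

/-- The system decouples in `p = x + y` and `q = x - y`. -/
theorem surjective_offDiagonalResolvent [CompleteSpace X] (hA : IsSelfAdjoint A) {ν : ℝ}
    (hν : ν ≠ 0) : Function.Surjective (offDiagonalResolvent A ν) := by
  intro w
  obtain ⟨p, hp⟩ := hA.exists_add_smul_I_eq (neg_ne_zero.mpr hν) (-(w.fst + w.snd))
  obtain ⟨q, hq⟩ := hA.exists_add_smul_I_eq hν (w.fst - w.snd)
  refine ⟨((2⁻¹ : ℂ) • (p + q), (2⁻¹ : ℂ) • (p - q)), ?_⟩
  rw [offDiagonalResolvent_apply]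
  push_cast at hp
  simp only [LinearPMap.map_smul, LinearPMap.map_add, LinearPMap.map_sub, Submodule.coe_smul,
    Submodule.coe_add, Submodule.coe_sub]
  refine congrArg (WithLp.toLp 2) (Prod.ext ?_ ?_)
  · change _ = w.fst
    linear_combination (norm := module) (-2⁻¹ : ℂ) • hp + (2⁻¹ : ℂ) • hq
  · change _ = w.snd
    linear_combination (norm := module) (-2⁻¹ : ℂ) • hp - (2⁻¹ : ℂ) • hq

theorem exists_block_eq [CompleteSpace X] (hA : IsSelfAdjoint A) {C B : A.domain →ₗ[ℂ] X}
    {c b μ : ℝ} (hc0 : 0 < c) (hc1 : c < 1)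
    (hC : ∀ x, ‖C x‖ ≤ c * ‖A x‖ + b * ‖(x : X)‖) (hB : ∀ x, ‖B x‖ ≤ c * ‖A x‖ + b * ‖(x : X)‖)
    (hμ0 : μ ≠ 0) (hμ : b ^ 2 ≤ c * (1 - c) * μ ^ 2) (f g : X) :
    ∃ x y : A.domain, C x - A y + (μ * I) • (x : X) = f ∧ -A x - B y + (μ * I) • (y : X) = g := by
  let K : (A.domain × A.domain) →ₗ[ℂ] WithLp 2 (X × X) :=
    (WithLp.linearEquiv 2 ℂ (X × X)).symm.toLinearMap ∘ₗ C.prodMap (-B)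
  have hKapp (z) : K z = WithLp.toLp 2 (C z.1, -B z.2) := rfl
  have hK (z) : ‖K z‖ ≤ √c * ‖offDiagonalResolvent A μ z‖ := by
    refine abs_le_of_sq_le_sq' ?_ (by positivity) |>.2
    rw [mul_pow, Real.sq_sqrt hc0.le, norm_sq_offDiagonalResolvent hA.isFormalAdjoint, hKapp,
      WithLp.prod_norm_sq_eq_of_L2]
    simp only [WithLp.toLp_fst, WithLp.toLp_snd, norm_neg]
    rw [mul_add]
    exact add_le_add
      ((pow_le_pow_left₀ (norm_nonneg _) (hC z.1) 2).trans (add_mul_sq_le_of_lt_one hc0 hc1 hμ))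
      ((pow_le_pow_left₀ (norm_nonneg _) (hB z.2) 2).trans (add_mul_sq_le_of_lt_one hc0 hc1 hμ))
  obtain ⟨⟨x, y⟩, h⟩ := LinearMap.surjective_add_of_norm_le
    (surjective_offDiagonalResolvent hA hμ0) (Real.sqrt_lt' one_pos |>.mpr (by simpa using hc1)) hK
    (WithLp.toLp 2 (f, g))
  rw [LinearMap.add_apply, offDiagonalResolvent_apply, hKapp, ← WithLp.toLp_add] at h
  have h := WithLp.toLp_injective 2 h
  rw [Prod.mk_add_mk, Prod.mk.injEq] at h
  refine ⟨x, y, ?_, ?_⟩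
  · rw [← h.1]; abel
  · rw [← h.2]; abel

end BlockPerturbation

theorem exists_scaled_block_eq {X : Type*} [NormedAddCommGroup X] [InnerProductSpace ℂ X]
    [CompleteSpace X] {A : X →ₗ.[ℂ] X} (hA : IsSelfAdjoint A) {C B : A.domain →ₗ[ℂ] X}
    {c₁ c₂ b₁ b₂ : ℝ} (hc₁ : 0 ≤ c₁) (hc₂ : 0 ≤ c₂) (hc : c₁ * c₂ < 1)
    (hC : ∀ x, ‖C x‖ ≤ c₁ * ‖A x‖ + b₁ * ‖(x : X)‖)
    (hB : ∀ x, ‖B x‖ ≤ c₂ * ‖A x‖ + b₂ * ‖(x : X)‖) :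
    ∃ p q : ℝ, ∀ ε : ℝ, |ε| = 1 → ∀ f g : X, ∃ x y : A.domain,
      C x - A y + (ε * p * I) • (x : X) = f ∧ -A x - B y + (ε * q * I) • (y : X) = g := by
  -- `s²` lies between `c₂` and `1 / c₁`; the `c₁ + 1` allows `c₁ = 0`.
  obtain ⟨s, hs, hs₁, hs₂⟩ : ∃ s : ℝ, 0 < s ∧ s ^ 2 * c₁ < 1 ∧ c₂ < s ^ 2 := by
    have hε : 0 < (1 - c₁ * c₂) / (2 * (c₁ + 1)) := div_pos (by linarith) (by linarith)
    refine ⟨√(c₂ + (1 - c₁ * c₂) / (2 * (c₁ + 1))), Real.sqrt_pos.mpr (by linarith), ?_, ?_⟩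
    · rw [Real.sq_sqrt (by linarith)]
      have h : (1 - c₁ * c₂) / (2 * (c₁ + 1)) * (2 * (c₁ + 1)) = 1 - c₁ * c₂ :=
        div_mul_cancel₀ _ (by positivity)
      nlinarith
    · rw [Real.sq_sqrt (by linarith)]
      linarith
  -- The floors `2⁻¹` and `0` only ensure `0 < c` and `0 ≤ b`.
  set c := max (max (s ^ 2 * c₁) ((s ^ 2)⁻¹ * c₂)) 2⁻¹
  set b := max (max (s ^ 2 * b₁) ((s ^ 2)⁻¹ * b₂)) 0
  have hc0 : 0 < c := lt_of_lt_of_le (by norm_num) (le_max_right _ _)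
  have hc1 : c < 1 := by
    refine max_lt (max_lt hs₁ ?_) (by norm_num)
    rwa [inv_mul_lt_iff₀ (by positivity), mul_one]
  have hb : 0 ≤ b := le_max_right _ _
  have hC' (x) : ‖((s : ℂ) ^ 2 • C) x‖ ≤ c * ‖A x‖ + b * ‖(x : X)‖ := by
    have h₁ : s ^ 2 * c₁ ≤ c := (le_max_left _ _).trans (le_max_left _ _)
    have h₂ : s ^ 2 * b₁ ≤ b := (le_max_left _ _).trans (le_max_left _ _)
    calc ‖((s : ℂ) ^ 2 • C) x‖ = s ^ 2 * ‖C x‖ := by simp [norm_smul]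
      _ ≤ s ^ 2 * (c₁ * ‖A x‖ + b₁ * ‖(x : X)‖) := by gcongr; exact hC x
      _ = s ^ 2 * c₁ * ‖A x‖ + s ^ 2 * b₁ * ‖(x : X)‖ := by ring
      _ ≤ _ := by gcongr
  have hB' (x) : ‖(((s : ℂ) ^ 2)⁻¹ • B) x‖ ≤ c * ‖A x‖ + b * ‖(x : X)‖ := by
    have h₁ : (s ^ 2)⁻¹ * c₂ ≤ c := (le_max_right _ _).trans (le_max_left _ _)
    have h₂ : (s ^ 2)⁻¹ * b₂ ≤ b := (le_max_right _ _).trans (le_max_left _ _)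
    calc ‖(((s : ℂ) ^ 2)⁻¹ • B) x‖ = (s ^ 2)⁻¹ * ‖B x‖ := by simp [norm_smul]
      _ ≤ (s ^ 2)⁻¹ * (c₂ * ‖A x‖ + b₂ * ‖(x : X)‖) := by gcongr; exact hB x
      _ = (s ^ 2)⁻¹ * c₂ * ‖A x‖ + (s ^ 2)⁻¹ * b₂ * ‖(x : X)‖ := by ring
      _ ≤ _ := by gcongr
  have hd : 0 < c * (1 - c) := mul_pos hc0 (by linarith)
  set μ := (b + 1) / (c * (1 - c))
  have hμ0 : 0 < μ := by positivity
  have hμ : b ^ 2 ≤ c * (1 - c) * μ ^ 2 := by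
    have h₁ : c * (1 - c) * μ = b + 1 := mul_div_cancel₀ _ hd.ne'
    have h₂ : b ≤ μ := by
      rw [le_div_iff₀ hd]
      nlinarith [sq_nonneg c]
    nlinarith
  refine ⟨(s ^ 2)⁻¹ * μ, s ^ 2 * μ, fun ε hε f g => ?_⟩
  have hε0 : ε ≠ 0 := by rintro rfl; simp at hε
  obtain ⟨x, y, hf, hg⟩ := exists_block_eq hA hc0 hc1 hC' hB' (mul_ne_zero hε0 hμ0.ne')
    (by rwa [mul_pow, ← sq_abs ε, hε, one_pow, one_mul]) ((s : ℂ) • f) ((s : ℂ)⁻¹ • g)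
  have hs0 : (s : ℂ) ≠ 0 := ofReal_ne_zero.mpr hs.ne'
  refine ⟨(s : ℂ) • x, (s : ℂ)⁻¹ • y, ?_, ?_⟩
  · rw [← inv_smul_smul₀ hs0 f, ← hf]
    simp only [map_smul, LinearPMap.map_smul, Submodule.coe_smul, LinearMap.smul_apply]
    push_cast
    match_scalars <;> field_simp
  · rw [← smul_inv_smul₀ hs0 g, ← hg]
    simp only [map_smul, LinearPMap.map_smul, Submodule.coe_smul, LinearMap.smul_apply]
    push_cast
    match_scalars <;> field_simp

/-! ### Symmetry and self-adjointness of `JH` -/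

theorem symplecticJ_compPMap_blockOperator_apply {X : Type*} [NormedAddCommGroup X]
    [InnerProductSpace ℂ X] {A B C : X →ₗ.[ℂ] X}
    (z : ((symplecticJ X).compPMap (blockOperator A B C (-A))).domain) :
    (symplecticJ X).compPMap (blockOperator A B C (-A)) z =
      WithLp.toLp 2 (C ⟨z.1.fst, z.2.1.2⟩ + -A ⟨z.1.snd, z.2.2.2⟩,
        -(A ⟨z.1.fst, z.2.1.1⟩ + B ⟨z.1.snd, z.2.2.1⟩)) := rfl

theorem isFormalAdjoint_symplecticJ_compPMap {X : Type*} [NormedAddCommGroup X]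
    [InnerProductSpace ℂ X] {A B C : X →ₗ.[ℂ] X} (hA : A.IsFormalAdjoint A)
    (hB : B.IsFormalAdjoint B) (hC : C.IsFormalAdjoint C) :
    ((symplecticJ X).compPMap (blockOperator A B C (-A))).IsFormalAdjoint
      ((symplecticJ X).compPMap (blockOperator A B C (-A))) := by
  intro z w
  have h1 := hC ⟨z.1.fst, z.2.1.2⟩ ⟨w.1.fst, w.2.1.2⟩
  have h2 := hA ⟨z.1.snd, z.2.2.2⟩ ⟨w.1.fst, w.2.1.1⟩
  have h3 := hA ⟨z.1.fst, z.2.1.1⟩ ⟨w.1.snd, w.2.2.2⟩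
  have h4 := hB ⟨z.1.snd, z.2.2.1⟩ ⟨w.1.snd, w.2.2.1⟩
  simp only [symplecticJ_compPMap_blockOperator_apply, WithLp.prod_inner_apply, inner_add_left,
    inner_add_right, inner_neg_left, inner_neg_right, WithLp.ofLp_fst, WithLp.ofLp_snd]
  linear_combination h1 - h2 - h3 - h4

/-- The real diagonal operator matrix `diag (p, q)`. -/
def realDiagonal (X : Type*) [NormedAddCommGroup X] [InnerProductSpace ℂ X] (p q : ℝ) :
    WithLp 2 (X × X) →ₗ[ℂ] WithLp 2 (X × X) :=
  (WithLp.linearEquiv 2 ℂ (X × X)).symm.toLinearMap ∘ₗ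
    (((p : ℂ) • LinearMap.id).prodMap ((q : ℂ) • LinearMap.id)) ∘ₗ
      (WithLp.linearEquiv 2 ℂ (X × X)).toLinearMap

theorem realDiagonal_apply {X : Type*} [NormedAddCommGroup X] [InnerProductSpace ℂ X] (p q : ℝ)
    (z : WithLp 2 (X × X)) :
    realDiagonal X p q z = WithLp.toLp 2 ((p : ℂ) • z.fst, (q : ℂ) • z.snd) := rfl

theorem isSymmetric_realDiagonal {X : Type*} [NormedAddCommGroup X] [InnerProductSpace ℂ X]
    (p q : ℝ) : (realDiagonal X p q).IsSymmetric := by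
  intro z w
  simp only [realDiagonal_apply, WithLp.prod_inner_apply, WithLp.ofLp_fst, WithLp.ofLp_snd,
    inner_smul_left, inner_smul_right, conj_ofReal]

theorem symplecticJ_compPMap_eq_adjoint {X : Type*} [NormedAddCommGroup X]
    [InnerProductSpace ℂ X] [CompleteSpace X] {A B C : X →ₗ.[ℂ] X} (hA : IsSelfAdjoint A)
    (hB : IsSelfAdjoint B) (hC : IsSelfAdjoint C)
    (hd : Dense ((blockOperator A B C (-A)).domain : Set (WithLp 2 (X × X))))
    {c₁ c₂ : ℝ} (h₁ : c₁ ∈ relBoundSet C A) (h₂ : c₂ ∈ relBoundSet B A) (hc : c₁ * c₂ < 1) :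
    (symplecticJ X).compPMap (blockOperator A B C (-A)) =
      ((symplecticJ X).compPMap (blockOperator A B C (-A)))† := by
  obtain ⟨hc₁, hAC, b₁, -, hCb⟩ := h₁
  obtain ⟨hc₂, hAB, b₂, -, hBb⟩ := h₂
  obtain ⟨p, q, hpq⟩ := exists_scaled_block_eq hA (C := C.toFun ∘ₗ Submodule.inclusion hAC)
    (B := B.toFun ∘ₗ Submodule.inclusion hAB) hc₁ hc₂ hc hCb hBb
  refine LinearPMap.eq_adjoint_of_surjective hd
    (isFormalAdjoint_symplecticJ_compPMap hA.isFormalAdjoint hB.isFormalAdjoint hC.isFormalAdjoint)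
    (isSymmetric_realDiagonal p q) (fun w => ?_) (fun w => ?_)
  · obtain ⟨x, y, hx, hy⟩ := hpq 1 (by simp) w.fst w.snd
    refine ⟨⟨WithLp.toLp 2 (x, y), ⟨x.2, hAC x.2⟩, ⟨hAB y.2, y.2⟩⟩, ?_⟩
    change C ⟨x, hAC x.2⟩ - A y + _ = _ at hx
    change -A x - B ⟨y, hAB y.2⟩ + _ = _ at hy
    refine congrArg (WithLp.toLp 2) (Prod.ext (Eq.trans ?_ hx) (Eq.trans ?_ hy))
    · change C ⟨x, hAC x.2⟩ + -A y + I • (p : ℂ) • (x : X) = _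
      push_cast
      module
    · change -(A x + B ⟨y, hAB y.2⟩) + I • (q : ℂ) • (y : X) = _
      push_cast
      module
  · obtain ⟨x, y, hx, hy⟩ := hpq (-1) (by simp) w.fst w.snd
    refine ⟨⟨WithLp.toLp 2 (x, y), ⟨x.2, hAC x.2⟩, ⟨hAB y.2, y.2⟩⟩, ?_⟩
    change C ⟨x, hAC x.2⟩ - A y + _ = _ at hx
    change -A x - B ⟨y, hAB y.2⟩ + _ = _ at hy
    refine congrArg (WithLp.toLp 2) (Prod.ext (Eq.trans ?_ hx) (Eq.trans ?_ hy))
    · change C ⟨x, hAC x.2⟩ + -A y - I • (p : ℂ) • (x : X) = _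
      push_cast
      module
    · change -(A x + B ⟨y, hAB y.2⟩) - I • (q : ℂ) • (y : X) = _
      push_cast
      module

theorem exists_mem_relBoundSet_mul_lt_one {E F G : Type*} [NormedAddCommGroup E]
    [NormedSpace ℂ E] [NormedAddCommGroup F] [NormedSpace ℂ F] [NormedAddCommGroup G]
    [NormedSpace ℂ G] {S S' : E →ₗ.[ℂ] F} {T : E →ₗ.[ℂ] G} (hS : IsRelBounded S T)
    (hS1 : relBound S T < 1) (hS' : IsRelBounded S' T) (hS'1 : relBound S' T ≤ 1) :
    ∃ a ∈ relBoundSet S T, ∃ a' ∈ relBoundSet S' T, a * a' < 1 := by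
  obtain ⟨a, ha, ha1⟩ := exists_lt_of_csInf_lt hS hS1
  have ha0 : 0 ≤ a := ha.1
  -- `a (2 - a) = 1 - (a - 1)² < 1`, so any `a' < 2 - a` will do.
  obtain ⟨a', ha', ha'1⟩ := exists_lt_of_csInf_lt hS' (hS'1.trans_lt (b := 1) (c := 2 - a) (by linarith))
  exact ⟨a, ha, a', ha', by nlinarith [sq_nonneg (a - 1), mul_le_mul_of_nonneg_left ha'1.le ha0]⟩

theorem corollary3p3 {X : Type*} [NormedAddCommGroup X] [InnerProductSpace ℂ X] [CompleteSpace X]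
    (A B C : X →ₗ.[ℂ] X) (hH : IsHamiltonianMatrix A B C)
    (hdom : (hamiltonianOperator A B C).domain = l2Prod A.domain A†.domain)
    (hA : IsSelfAdjoint A)
    (hbound :
      ((IsRelBounded C A ∧ relBound C A < 1) ∧ (IsRelBounded B A† ∧ relBound B A† ≤ 1)) ∨
      ((IsRelBounded C A ∧ relBound C A ≤ 1) ∧ (IsRelBounded B A† ∧ relBound B A† < 1))) :
    (symplecticJ X).compPMap (hamiltonianOperator A B C) =
      ((symplecticJ X).compPMap (hamiltonianOperator A B C))† := by
  have hd := hH.dense_H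
  unfold hamiltonianOperator at hd ⊢
  rw [LinearPMap.isSelfAdjoint_def.mp hA] at hbound hd ⊢
  obtain ⟨c₁, h₁, c₂, h₂, hc⟩ :
      ∃ c₁ ∈ relBoundSet C A, ∃ c₂ ∈ relBoundSet B A, c₁ * c₂ < 1 := by
    rcases hbound with ⟨⟨hC, hC1⟩, hB, hB1⟩ | ⟨⟨hC, hC1⟩, hB, hB1⟩
    · exact exists_mem_relBoundSet_mul_lt_one hC hC1 hB hB1
    · obtain ⟨a, ha, a', ha', h⟩ := exists_mem_relBoundSet_mul_lt_one hB hB1 hC hC1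
      exact ⟨a', ha', a, ha, by rwa [mul_comm]⟩
  exact symplecticJ_compPMap_eq_adjoint hA hH.selfAdjoint_B hH.selfAdjoint_C hd h₁ h₂ hc
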